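/- **Setting.** Consider the rank-$6$ quartic melonic $U(1)$ tensor field theory with gauge invariance, in momentum space, with mass $m>0$; fix $M>1$. The propagator is $C(\vec p)=\delta\big(\sum_{c}p_c\big)\,(|\vec p|^2+m^2)^{-1}$ for $\vec p=(p_1,\dots,p_6)\in\mathbb Z^6$, where $\delta$ is the Kronecker symbol. It is sliced by sharp cutoffs as $C_i=C\chi_i$, $i\ge 1$, where $\chi_1$ is the indicator function of $|\vec p|^2\le M^2$ and $\chi_i$, for $i\ge 2$, is the indicator function of $M^{2(i-1)}<|\vec p|^2\le M^{2i}$. A *Feynman graph* $\mathcal G$ (finite, connected or not) has as vertices quartic melonic bubbles. A bubble has a special color in $\{1,\dots,6\}$; for special color $1$ it is the invariant $$\sum_{\vec p,\vec p\,'}\bar\phi(p_1,p_2,\dots,p_6)\,\phi(p'_1,p_2,\dots,p_6)\,\bar\phi(p'_1,p'_2,\dots,p'_6)\,\phi(p_1,p'_2,\dots,p'_6),$$ and similarly for the other colors. The internal lines of $\mathcal G$ are Wick contractions of a $\phi$ with a $\bar\phi$; the uncontracted fields are the external half-lines. A *face* of color $c$ is a connected component of the graph whose nodes are the fields and whose edges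 are the lines and the color-$c$ pairings of fields inside the bubbles; it is internal if it contains no external half-line, and external otherwise. Each face carries a momentum in $\mathbb Z$, and the component $p^\ell_c$ of the momentum $\vec p^{\,\ell}$ of a line $\ell$ is the momentum of the face of color $c$ through $\ell$. A *subgraph* $\mathcal H$ is a set of lines of $\mathcal G$, with the vertices attached to them; its internal faces are the faces of $\mathcal G$ all of whose fields are ends of lines of $\mathcal H$. Let $L(\mathcal H)$ be its number of lines, $F(\mathcal H)$ its number of internal faces, and $R(\mathcal H)$ the rank of its incidence matrix $\epsilon_{\ell f}$ between lines and internal faces (nonzero iff $\ell$ belongs to $f$, and then $\pm1$ according to the relative orientation; with all lines oriented from $\phi$ to $\bar\phi$ and the faces oriented along them, every nonzero entry is $+1$). The *divergence degree* is $$\omega(\mathcal H)=-2L(\mathcal H)+F(\mathcal H)-R(\mathcal H).$$ A *scale attribution* with cutoff $\rho$ is a family $\mu=\{i_\ell\}$ of integers $1\le i_\ell\le\rho$ indexed by the internal lines. For fixed momenta of the external faces, the (amputated) amplitude is $$\mathcal A_\mu(\mathcal G)=\sum_{(p_f)\in\mathbb Z^{F_{\mathrm{int}}(\mathcal G)}}\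 \prod_{\ell}C_{i_\ell}(\vec p^{\,\ell}),$$ where $F_{\mathrm{int}}(\mathcal G)$ is the set of internal faces of $\mathcal G$. For $1\le i\le\rho$ let $\mathcal G_i$ be the subgraph of the lines with $i_\ell\ge i$, and let $\mathcal G_i^1,\dots,\mathcal G_i^{k(i)}$ be its connected components (two lines being adjacent if they are attached to a common vertex). **Theorem.** For all $M>1$ and $m>0$ there is a constant $K>0$, depending only on $M$ and $m$, such that for every Feynman graph $\mathcal G$, every cutoff $\rho$, every scale attribution $\mu$ with cutoff $\rho$, and all momenta of the external faces, the sum defining $\mathcal A_\mu(\mathcal G)$ converges absolutely and $$|\mathcal A_\mu(\mathcal G)|\ \le\ K^{L(\mathcal G)}\prod_{i=1}^{\rho}\ \prod_{k=1}^{k(i)}M^{\omega(\mathcal G_i^k)} .$$ -/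

import Mathlib

/-! Feynman graphs, multiscale amplitudes and power counting for the quartic melonic `U(1)` tensor
group field theory of rank `6` with gauge invariance, in momentum space, with sharp cutoffs. -/

namespace TGFT

noncomputable section

/-- A Feynman graph with set of vertices `V` and set of internal lines `L`.

A vertex `v` is a quartic melonic bubble of special color `color v`. It carries two fields `φ`,
labelled `(v, false)` and `(v, true)`, and two fields `φ̄`, labelled likewise. An internal line is a
Wick contraction of a field `φ` (its source) with a field `φ̄` (its target), and each field is
contracted at most once. The fields that are not contracted are the external half-lines. The graph
need not be connected. -/
structure FeynmanGraph (V L : Type*) where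
  color : V → Fin 6
  src : L → V × Bool
  tgt : L → V × Bool
  src_injective : Function.Injective src
  tgt_injective : Function.Injective tgt

/-- The nodes of the edge-colored graph of a Feynman graph: one for each field `φ` (white) and one
for each field `φ̄` (black). -/
inductive Node (V : Type*) where
  | phi (h : V × Bool) : Node V
  | phiBar (h : V × Bool) : Node V

/-- `Node V` is two copies of `V × Bool`. -/
def nodeEquiv (V : Type*) : Node V ≃ (V × Bool) ⊕ (V × Bool) where
  toFun
    | .phi h => .inl h
    | .phiBar h => .inr h
  invFun
    | .inl h => .phi h
    | .inr h => .phiBar h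
  left_inv x := by cases x <;> rfl
  right_inv x := by cases x <;> rfl

instance (V : Type*) [Finite V] : Finite (Node V) := Finite.of_equiv _ (nodeEquiv V).symm

namespace FeynmanGraph

variable {V L : Type*} (G : FeynmanGraph V L)

/-- The field `φ` whose argument of color `c` is identified, inside the bubble, with the argument of
color `c` of the field `φ̄` labelled `h`. With special color `1`, the bubble is
`∑ φ̄(p₁,p₂,…,p₆) φ(p'₁,p₂,…,p₆) φ̄(p'₁,p'₂,…,p'₆) φ(p₁,p'₂,…,p'₆)`,
whose fields are, in this order, `φ̄` with label `false`, `φ` with label `false`, `φ̄` with label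
`true`, `φ` with label `true`. -/
def partner (c : Fin 6) (h : V × Bool) : V × Bool :=
  (h.1, if c = G.color h.1 then !h.2 else h.2)

/-- The edges of color `0` (the lines) and of color `c` of the edge-colored graph. -/
inductive BicoloredEdge (c : Fin 6) : Node V → Node V → Prop
  | line (l : L) : BicoloredEdge c (.phi (G.src l)) (.phiBar (G.tgt l))
  | strand (h : V × Bool) : BicoloredEdge c (.phiBar h) (.phi (G.partner c h))

/-- A face of color `c` is a connected component of the graph made of the edges of colors `0`
and `c`. -/
def Face : Type _ := Σ c : Fin 6, Quotient (Relation.EqvGen.setoid (G.BicoloredEdge c))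

/-- The face of color `c` through a node. -/
def faceOf (c : Fin 6) (x : Node V) : G.Face :=
  ⟨c, Quotient.mk (Relation.EqvGen.setoid (G.BicoloredEdge c)) x⟩

/-- The face to which the strand of color `c` of the line `l` belongs. -/
def strandFace (l : L) (c : Fin 6) : G.Face := G.faceOf c (.phi (G.src l))

/-- The node `x` is an end of the line `l`. -/
def IsEnd (l : L) (x : Node V) : Prop := x = .phi (G.src l) ∨ x = .phiBar (G.tgt l)

/-- A subgraph is a set `S` of lines, with the vertices attached to them. The face `f` is an internal
(closed) face of the subgraph if it meets no external half-line of it: every node of `f` is an end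
of a line of `S`. -/
def IsInternal (S : Set L) (f : G.Face) : Prop :=
  ∀ x : Node V, G.faceOf f.1 x = f → ∃ l ∈ S, G.IsEnd l x

/-- The internal faces of the subgraph `S`. -/
def InternalFace (S : Set L) : Type _ := {f : G.Face // G.IsInternal S f}

/-- The external (open) faces of the whole graph. -/
def ExternalFace : Type _ := {f : G.Face // ¬ G.IsInternal Set.univ f}

instance [Finite V] : Finite G.Face :=
  inferInstanceAs (Finite (Σ c : Fin 6, Quotient (Relation.EqvGen.setoid (G.BicoloredEdge c))))

instance [Finite V] (S : Set L) : Finite (G.InternalFace S) :=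
  inferInstanceAs (Finite {f : G.Face // G.IsInternal S f})

instance [Finite V] (S : Set L) : Fintype (G.InternalFace S) := Fintype.ofFinite _

open Classical in
/-- The line-face incidence matrix of the subgraph `S`. Every line is oriented from `φ` to `φ̄`, and
a face runs through all its lines in the same direction, so that all relative orientations
are `+1`. A line meets a face at most once, since its six strands have different colors. -/
def incidence (S : Set L) : Matrix S (G.InternalFace S) ℚ :=
  fun l f => if ∃ c, G.strandFace l.1 c = f.1 then 1 else 0

/-- The number `L(S)` of lines. -/
def numLines (_G : FeynmanGraph V L) (S : Set L) : ℕ := S.ncard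

/-- The number `F(S)` of internal faces. -/
def numFaces (S : Set L) : ℕ := Nat.card (G.InternalFace S)

/-- The rank `R(S)` of the incidence matrix. -/
def incidenceRank [Finite V] (S : Set L) : ℕ := (G.incidence S).rank

/-- The divergence degree `ω = -2L + F - R`. -/
def divDegree [Finite V] (S : Set L) : ℤ :=
  -2 * (G.numLines S : ℤ) + (G.numFaces S : ℤ) - (G.incidenceRank S : ℤ)

/-- The vertex `v` is attached to the line `l`. -/
def Attached (l : L) (v : V) : Prop := v = (G.src l).1 ∨ v = (G.tgt l).1

/-- Two different lines of `S` are adjacent if they are attached to a common vertex. -/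
def lineGraph (S : Set L) : SimpleGraph S where
  Adj a b := a ≠ b ∧ ∃ v, G.Attached a.1 v ∧ G.Attached b.1 v
  symm := ⟨fun _ _ h => ⟨h.1.symm, h.2.imp fun _ hv => ⟨hv.2, hv.1⟩⟩⟩
  loopless := ⟨fun _ h => h.1 rfl⟩

/-- The connected components of the subgraph `S`, each of them as a set of lines. -/
def components [Finite L] (S : Set L) : Finset (Set L) :=
  (Set.toFinite (Set.range fun k : (G.lineGraph S).ConnectedComponent =>
    ((↑) : S → L) '' k.supp)).toFinset

/-- The subgraph `G_i` of the lines of scale at least `i`. -/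
def highSubgraph (_G : FeynmanGraph V L) (μ : L → ℕ) (i : ℕ) : Set L := {l | i ≤ μ l}

open Classical in
/-- The momentum `(p₁,…,p₆)` of the line `l`, when the internal faces carry the momenta `p` and the
external faces carry the momenta `q`. -/
def lineMomentum (q : G.ExternalFace → ℤ) (p : G.InternalFace Set.univ → ℤ) (l : L) : Fin 6 → ℤ :=
  fun c => if h : G.IsInternal Set.univ (G.strandFace l c) then p ⟨_, h⟩ else q ⟨_, h⟩

end FeynmanGraph

/-- The squared Euclidean norm `|p|²` of a momentum. -/
def normSq (p : Fin 6 → ℤ) : ℝ := ∑ c, (p c : ℝ) ^ 2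

/-- The propagator `C(p) = δ(∑ p_c) / (|p|² + m²)`. -/
def propagator (m : ℝ) (p : Fin 6 → ℤ) : ℝ :=
  if ∑ c, p c = 0 then 1 / (normSq p + m ^ 2) else 0

open Classical in
/-- The sharp cutoff `χ_i` for `i ≥ 1`: the indicator function of `|p|² ≤ M²` for `i = 1`, and of
`M^(2(i-1)) < |p|² ≤ M^(2i)` for `i ≥ 2`. -/
def cutoff (M : ℝ) (i : ℕ) (p : Fin 6 → ℤ) : ℝ :=
  if normSq p ≤ M ^ (2 * i) ∧ (2 ≤ i → M ^ (2 * (i - 1)) < normSq p) then 1 else 0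

/-- The propagator `C_i` of scale `i`. -/
def slicedPropagator (M m : ℝ) (i : ℕ) (p : Fin 6 → ℤ) : ℝ := propagator m p * cutoff M i p

namespace FeynmanGraph

variable {V L : Type*} [Fintype L] (G : FeynmanGraph V L)

/-- The contribution to the amplitude of given momenta of the internal faces. -/
def integrand (M m : ℝ) (μ : L → ℕ) (q : G.ExternalFace → ℤ)
    (p : G.InternalFace Set.univ → ℤ) : ℝ :=
  ∏ l, slicedPropagator M m (μ l) (G.lineMomentum q p l)

/-- The (amputated) amplitude `A_μ(G)` with scale attribution `μ` and external momenta `q`, as the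
sum over the momenta of the internal faces. -/
def amplitude (M m : ℝ) (μ : L → ℕ) (q : G.ExternalFace → ℤ) : ℝ :=
  ∑' p : G.InternalFace Set.univ → ℤ, G.integrand M m μ q p

end FeynmanGraph

end

end TGFT

/-! Momentum conservation on the lines is a linear system whose matrix is the incidence matrix, so
the momenta of the faces outside of a basis of its columns (the free faces) determine all the
others. A face is internal to `G_i` exactly when `i` is at most its scale, the least scale of its
lines, and its momentum is cut off at that scale. Bounding the sum over the momentum of each free
face `f` by `3 * M ^ faceScale μ f` and the propagator of each line `l` by a constant times
`M ^ (-2 * μ l)`, and writing each scale as the number of slices below it, gives the power counting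
`F - |basis| - 2L` in each `G_i`. It is at most the total degree of the components of `G_i` provided
that the basis is chosen greedily from the high scales to the low ones: its faces internal to `G_i`
then span the columns of all the faces internal to `G_i`, hence the columns of each component, on
whose lines the faces of the other components vanish. -/

namespace TGFT

section Preliminaries

theorem prod_zpow_eq_zpow_sum {ι G₀ : Type*} [CommGroupWithZero G₀] {a : G₀} (ha : a ≠ 0)
    (s : Finset ι) (w : ι → ℤ) : ∏ x ∈ s, a ^ w x = a ^ ∑ x ∈ s, w x := by
  induction s using Finset.cons_induction with
  | empty => simp
  | cons x s hx ih => rw [Finset.prod_cons, Finset.sum_cons, zpow_add₀ ha, ih]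

theorem sum_card_filter_le_eq_sum {ι : Type*} (s : Finset ι) {w : ι → ℕ} {ρ : ℕ}
    (hw : ∀ x ∈ s, w x ≤ ρ) :
    ∑ i ∈ Finset.Icc 1 ρ, (s.filter fun x => i ≤ w x).card = ∑ x ∈ s, w x := by
  refine (Finset.sum_card_bipartiteAbove_eq_sum_card_bipartiteBelow fun i x => i ≤ w x).trans
    (Finset.sum_congr rfl fun x hx => ?_)
  have hIcc : (Finset.Icc 1 ρ).bipartiteBelow (fun i x => i ≤ w x) x = Finset.Icc 1 (w x) := by
    ext i
    have := hw x hx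
    simp only [Finset.mem_bipartiteBelow, Finset.mem_Icc]
    omega
  rw [hIcc, Nat.card_Icc, Nat.add_sub_cancel]

theorem norm_tsum_le_ncard_mul {α E : Type*} [NormedAddCommGroup E] {f : α → E} {A : Set α}
    (hA : A.Finite) (hf : Function.support f ⊆ A) {b : ℝ} (hb : ∀ x ∈ A, ‖f x‖ ≤ b) :
    ‖∑' x, f x‖ ≤ A.ncard * b := by
  have hsum : ∑' x, f x = ∑ x ∈ hA.toFinset, f x :=
    tsum_eq_sum fun x hx => Function.notMem_support.1 fun h => hx (hA.mem_toFinset.2 (hf h))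
  calc ‖∑' x, f x‖ ≤ ∑ _x ∈ hA.toFinset, b :=
        hsum ▸ norm_sum_le_of_le _ fun x hx => hb x (hA.mem_toFinset.1 hx)
    _ = A.ncard * b := by
        rw [Finset.sum_const, nsmul_eq_mul, Set.ncard_eq_toFinset_card A hA]

theorem ncard_le_prod_of_injOn_restrict {ι : Type*} {A : Set (ι → ℤ)} {s : Finset ι} {N : ι → ℕ}
    (hinj : Set.InjOn s.restrict A) (hA : ∀ p ∈ A, ∀ i ∈ s, (p i).natAbs ≤ N i) :
    A.ncard ≤ ∏ i ∈ s, (2 * N i + 1) := by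
  classical
  let box : Finset (s → ℤ) := Fintype.piFinset fun i => Finset.Icc (-(N i : ℤ)) (N i)
  have hbox : ∀ p ∈ A, s.restrict p ∈ (box : Set (s → ℤ)) := fun p hp => by
    refine Finset.mem_coe.2 (Fintype.mem_piFinset.2 fun i => Finset.mem_Icc.2 (abs_le.1 ?_))
    rw [Int.abs_eq_natAbs]
    exact_mod_cast hA p hp i i.2
  have hside : ∀ i, (Finset.Icc (-(N i : ℤ)) (N i)).card = 2 * N i + 1 := fun i => by
    rw [Int.card_Icc]
    omega
  calc A.ncard ≤ box.card := by
        simpa only [Set.ncard_coe_finset] using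
          Set.ncard_le_ncard_of_injOn _ hbox hinj box.finite_toSet
    _ = ∏ i ∈ s, (2 * N i + 1) := by
        simp only [box, Fintype.card_piFinset, hside]
        exact Finset.prod_coe_sort s fun i => 2 * N i + 1

theorem exists_linearIndepOn_adapted_to_antitone {K E ι α : Type*} [DivisionRing K]
    [AddCommGroup E] [Module K E] [LinearOrder α] (v : ι → E) {t : α → Set ι} (ht : Antitone t)
    (s : Finset α) :
    ∃ B ⊆ ⋃ a ∈ s, t a, LinearIndepOn K v B ∧
      ∀ a ∈ s, v '' t a ⊆ Submodule.span K (v '' (t a ∩ B)) := by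
  induction s using Finset.induction_on_min with
  | empty => exact ⟨∅, Set.empty_subset _, linearIndepOn_empty K v, by simp⟩
  | insert a s ha ih =>
    obtain ⟨B, hBs, hli, hspan⟩ := ih
    have hBa : B ⊆ t a := hBs.trans (Set.iUnion₂_subset fun b hb => ht (ha b hb).le)
    obtain ⟨B', hB'a, hBB', hspan', hli'⟩ := exists_linearIndepOn_extension hli hBa
    refine ⟨B', hB'a.trans (Set.subset_biUnion_of_mem (Finset.mem_insert_self a s)), hli', ?_⟩
    intro b hb
    obtain rfl | hbs := Finset.mem_insert.1 hb
    · rwa [Set.inter_eq_right.2 hB'a]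
    · exact (hspan b hbs).trans
        (Submodule.span_mono (Set.image_mono (Set.inter_subset_inter_right _ hBB')))

theorem eq_zero_of_mulVec_eq_zero_of_linearIndepOn {m n R : Type*} [Fintype n] [CommRing R]
    {A : Matrix m n R} {s : Set n} (hs : LinearIndepOn R A.col s) {x : n → R}
    (hx : A.mulVec x = 0) (hxs : ∀ j ∉ s, x j = 0) : x = 0 := by
  classical
  have hsum : ∑ j ∈ s.toFinset, x j • A.col j = 0 := by
    rw [← hx, Matrix.mulVec_eq_sum]
    simp only [op_smul_eq_smul]
    refine Finset.sum_subset (Finset.subset_univ _) fun j _ hj => ?_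
    rw [hxs j (by simpa using hj), zero_smul]
  funext j
  by_cases hj : j ∈ s
  · exact linearIndepOn_iff'.1 hs s.toFinset x (by simp) hsum j (by simpa using hj)
  · exact hxs j hj

end Preliminaries

namespace FeynmanGraph

variable {V L : Type*} {G : FeynmanGraph V L}

section Faces

theorem isEnd_src (l : L) : G.IsEnd l (.phi (G.src l)) := Or.inl rfl

theorem isEnd_tgt (l : L) : G.IsEnd l (.phiBar (G.tgt l)) := Or.inr rfl

theorem IsEnd.line_unique {l l' : L} {x : Node V} (h : G.IsEnd l x) (h' : G.IsEnd l' x) :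
    l = l' := by
  rcases h with rfl | rfl <;> rcases h' with h' | h'
  · exact G.src_injective (Node.phi.inj h')
  · cases h'
  · cases h'
  · exact G.tgt_injective (Node.phiBar.inj h')

theorem IsEnd.attached_phi {l : L} {h : V × Bool} (hl : G.IsEnd l (.phi h)) :
    G.Attached l h.1 := by
  rcases hl with hl | hl
  · exact Or.inl (congrArg Prod.fst (Node.phi.inj hl))
  · cases hl

theorem IsEnd.attached_phiBar {l : L} {h : V × Bool} (hl : G.IsEnd l (.phiBar h)) :
    G.Attached l h.1 := by
  rcases hl with hl | hl
  · cases hl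
  · exact Or.inr (congrArg Prod.fst (Node.phiBar.inj hl))

theorem faceOf_eq_iff {c : Fin 6} {x y : Node V} :
    G.faceOf c x = G.faceOf c y ↔ Relation.EqvGen (G.BicoloredEdge c) x y :=
  ⟨fun h => Quotient.exact (eq_of_heq (Sigma.mk.inj h).2),
    fun h => congrArg (Sigma.mk c) (Quotient.sound h)⟩

theorem exists_faceOf_eq (f : G.Face) : ∃ x, G.faceOf f.1 x = f := by
  obtain ⟨c, q⟩ := f
  induction q using Quotient.inductionOn with
  | h x => exact ⟨x, rfl⟩

theorem IsEnd.faceOf_eq {l : L} {x : Node V} (h : G.IsEnd l x) (c : Fin 6) :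
    G.faceOf c x = G.strandFace l c := by
  rcases h with rfl | rfl
  · rfl
  · exact faceOf_eq_iff.2 (.symm _ _ (.rel _ _ (.line l)))

theorem strandFace_injective (l : L) : Function.Injective (G.strandFace l) :=
  fun _ _ h => congrArg Sigma.fst h

namespace IsInternal

variable {S T : Set L} {f : G.Face}

theorem mono (h : S ⊆ T) (hf : G.IsInternal S f) : G.IsInternal T f :=
  fun x hx => (hf x hx).imp fun _ hl => ⟨h hl.1, hl.2⟩

theorem exists_strandFace_eq (hf : G.IsInternal S f) : ∃ l ∈ S, G.strandFace l f.1 = f := by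
  obtain ⟨x, hx⟩ := exists_faceOf_eq f
  obtain ⟨l, hl, he⟩ := hf x hx
  exact ⟨l, hl, (he.faceOf_eq _).symm.trans hx⟩

theorem mem_of_strandFace_eq (hf : G.IsInternal S f) {l : L} (h : G.strandFace l f.1 = f) :
    l ∈ S := by
  obtain ⟨l', hl', he⟩ := hf _ h
  rwa [(isEnd_src l).line_unique he]

theorem of_forall_mem (hf : G.IsInternal S f) (h : ∀ l, G.strandFace l f.1 = f → l ∈ T) :
    G.IsInternal T f := by
  intro x hx
  obtain ⟨l, -, he⟩ := hf x hx
  exact ⟨l, h l ((he.faceOf_eq _).symm.trans hx), he⟩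

end IsInternal

/-- The internal faces of the subgraph `S`, as a set of internal faces of the whole graph, so that
all subgraphs share one index type for the columns of the incidence matrix. -/
def internalFaces (G : FeynmanGraph V L) (S : Set L) : Set (G.InternalFace Set.univ) :=
  {f | G.IsInternal S f.1}

theorem internalFaces_mono : Monotone G.internalFaces := fun _ _ h _ hf => hf.mono h

theorem numFaces_eq_ncard_internalFaces (S : Set L) :
    G.numFaces S = (G.internalFaces S).ncard :=
  (Nat.card_congr
    (Equiv.subtypeSubtypeEquivSubtype fun hf => hf.mono (Set.subset_univ S))).symm

end Faces

section Components

theorem reachable_of_attached {S : Set L} {a b : S} {v : V} (ha : G.Attached a.1 v)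
    (hb : G.Attached b.1 v) : (G.lineGraph S).Reachable a b := by
  by_cases hab : a = b
  · exact hab ▸ .refl _
  · exact SimpleGraph.Adj.reachable ⟨hab, v, ha, hb⟩

theorem BicoloredEdge.reachable {S : Set L} {c : Fin 6} {x y : Node V}
    (h : G.BicoloredEdge c x y) {a b : S} (ha : G.IsEnd a.1 x) (hb : G.IsEnd b.1 y) :
    (G.lineGraph S).Reachable a b := by
  cases h with
  | line l =>
    obtain rfl : a = b :=
      Subtype.ext ((ha.line_unique (isEnd_src l)).trans ((isEnd_tgt l).line_unique hb))
    exact .refl _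
  | strand h => exact reachable_of_attached ha.attached_phiBar hb.attached_phi

theorem reachable_of_eqvGen {S : Set L} {c : Fin 6} {x y : Node V}
    (h : Relation.EqvGen (G.BicoloredEdge c) x y) (hx : G.IsInternal S (G.faceOf c x)) {a b : S}
    (ha : G.IsEnd a.1 x) (hb : G.IsEnd b.1 y) : (G.lineGraph S).Reachable a b := by
  induction h generalizing a b with
  | rel x y h => exact h.reachable ha hb
  | refl x =>
    obtain rfl : a = b := Subtype.ext (ha.line_unique hb)
    exact .refl _
  | symm x y h ih => exact (ih (faceOf_eq_iff.2 h ▸ hx) hb ha).symm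
  | trans x y z hxy _ ih₁ ih₂ =>
    have hy : G.faceOf c x = G.faceOf c y := faceOf_eq_iff.2 hxy
    obtain ⟨l, hl, hly⟩ := hx y hy.symm
    have hay : (G.lineGraph S).Reachable a ⟨l, hl⟩ := ih₁ hx ha hly
    exact hay.trans (ih₂ (hy ▸ hx) hly hb)

theorem IsInternal.reachable {S : Set L} {f : G.Face} (hf : G.IsInternal S f) {a b : S}
    (ha : G.strandFace a.1 f.1 = f) (hb : G.strandFace b.1 f.1 = f) :
    (G.lineGraph S).Reachable a b :=
  reachable_of_eqvGen (c := f.1) (faceOf_eq_iff.1 (ha.trans hb.symm)) (ha.symm ▸ hf)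
    (isEnd_src _) (isEnd_src _)

variable [Finite L] {S H : Set L}

theorem mem_components :
    H ∈ G.components S ↔
      ∃ k : (G.lineGraph S).ConnectedComponent, ((↑) : S → L) '' k.supp = H := by
  simp [components]

theorem subset_of_mem_components (hH : H ∈ G.components S) : H ⊆ S := by
  obtain ⟨k, rfl⟩ := mem_components.1 hH
  rintro _ ⟨l, -, rfl⟩
  exact l.2

theorem components_pairwiseDisjoint (S : Set L) :
    (G.components S : Set (Set L)).PairwiseDisjoint id := by
  intro H hH H' hH' hne
  obtain ⟨k, rfl⟩ := mem_components.1 hH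
  obtain ⟨k', rfl⟩ := mem_components.1 hH'
  have hkk' : k ≠ k' := fun h => hne (h ▸ rfl)
  exact (Set.disjoint_image_iff Subtype.val_injective).2
    ((G.lineGraph S).pairwise_disjoint_supp_connectedComponent hkk')

theorem exists_mem_components {l : L} (hl : l ∈ S) : ∃ H ∈ G.components S, l ∈ H :=
  ⟨_, mem_components.2 ⟨(G.lineGraph S).connectedComponentMk ⟨l, hl⟩, rfl⟩, ⟨l, hl⟩, rfl, rfl⟩

theorem biUnion_components (S : Set L) : ⋃ H ∈ G.components S, H = S := by
  refine (Set.iUnion₂_subset fun H => subset_of_mem_components).antisymm fun l hl => ?_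
  obtain ⟨H, hH, hlH⟩ := G.exists_mem_components hl
  exact Set.mem_biUnion hH hlH

theorem sum_ncard_components (S : Set L) : ∑ H ∈ G.components S, H.ncard = S.ncard := by
  have h := (G.components S).finite_toSet.ncard_biUnion (s := id) (fun _ _ => Set.toFinite _)
    (components_pairwiseDisjoint S)
  rw [finsum_mem_coe_finset] at h
  exact h.symm.trans (congrArg Set.ncard (biUnion_components S))

theorem IsInternal.of_mem_components (hH : H ∈ G.components S) {f : G.Face}
    (hf : G.IsInternal S f) {l : L} (hl : l ∈ H) (hlf : G.strandFace l f.1 = f) :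
    G.IsInternal H f := by
  obtain ⟨k, rfl⟩ := mem_components.1 hH
  obtain ⟨a, ha, rfl⟩ := hl
  refine hf.of_forall_mem fun b hb => ⟨⟨b, hf.mem_of_strandFace_eq hb⟩, ?_, rfl⟩
  exact (SimpleGraph.ConnectedComponent.sound (hf.reachable (by exact hb) hlf)).trans ha

theorem internalFaces_eq_biUnion_components (S : Set L) :
    G.internalFaces S = ⋃ H ∈ G.components S, G.internalFaces H := by
  refine Set.Subset.antisymm (fun f hf => ?_) (Set.iUnion₂_subset fun H hH =>
    internalFaces_mono (subset_of_mem_components hH))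
  obtain ⟨l, hl, hlf⟩ := IsInternal.exists_strandFace_eq hf
  obtain ⟨H, hH, hlH⟩ := G.exists_mem_components hl
  exact Set.mem_biUnion hH (IsInternal.of_mem_components hH hf hlH hlf)

theorem ncard_internalFaces_inter_le (S : Set L) (T : Set (G.InternalFace Set.univ)) :
    (G.internalFaces S ∩ T).ncard ≤ ∑ H ∈ G.components S, (G.internalFaces H ∩ T).ncard := by
  rw [internalFaces_eq_biUnion_components, Set.iUnion₂_inter]
  exact Finset.set_ncard_biUnion_le _ _

end Components

section DivergenceDegree

/-- The columns, in the incidence matrix of the whole graph, of the internal faces of `S` are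
spanned by those of the internal faces of `S` outside of `T`. Thus the rank of the incidence matrix
of `S` is at most the number of the latter, and this passes to the connected components of `S`. -/
def ColumnsSpannedOutside (G : FeynmanGraph V L) (T : Set (G.InternalFace Set.univ)) (S : Set L) :
    Prop :=
  (G.incidence Set.univ).col '' G.internalFaces S ⊆
    Submodule.span ℚ ((G.incidence Set.univ).col '' (G.internalFaces S \ T))

variable [Finite L] {S H : Set L} {T : Set (G.InternalFace Set.univ)}

theorem incidence_eq_zero_of_mem_components (hH : H ∈ G.components S)
    {f : G.InternalFace Set.univ} (hf : f ∈ G.internalFaces S \ G.internalFaces H) {l : L}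
    (hl : l ∈ H) : G.incidence Set.univ ⟨l, trivial⟩ f = 0 := by
  refine if_neg ?_
  rintro ⟨c, hc⟩
  obtain rfl : c = f.1.1 := congrArg Sigma.fst hc
  exact hf.2 (IsInternal.of_mem_components hH hf.1 hl hc)

variable [Finite V]

theorem incidenceRank_le_ncard_diff (hH : H ∈ G.components S) (hT : G.ColumnsSpannedOutside T S) :
    G.incidenceRank H ≤ (G.internalFaces H \ T).ncard := by
  classical
  let col := (G.incidence Set.univ).col
  let restrict := LinearMap.funLeft ℚ ℚ (Set.inclusion (Set.subset_univ H))
  let W : Set (H → ℚ) := (fun f => restrict (col f)) '' (G.internalFaces H \ T)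
  have hbasis : Submodule.span ℚ (col '' (G.internalFaces S \ T)) ≤
      (Submodule.span ℚ W).comap restrict := by
    refine Submodule.span_le.2 ?_
    rintro _ ⟨f, ⟨hfS, hfT⟩, rfl⟩
    by_cases hfH : f ∈ G.internalFaces H
    · exact Submodule.subset_span ⟨f, ⟨hfH, hfT⟩, rfl⟩
    · have hzero : restrict (col f) = 0 :=
        funext fun l => incidence_eq_zero_of_mem_components hH ⟨hfS, hfH⟩ l.2
      exact Submodule.mem_comap.2 (hzero ▸ Submodule.zero_mem _)
  have hcols : Submodule.span ℚ (Set.range (G.incidence H).col) ≤ Submodule.span ℚ W := by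
    refine Submodule.span_le.2 ?_
    rintro _ ⟨f, rfl⟩
    exact hbasis (hT ⟨⟨f.1, f.2.mono (Set.subset_univ H)⟩,
      f.2.mono (subset_of_mem_components hH), rfl⟩)
  have := Fintype.ofFinite W
  calc G.incidenceRank H = Module.finrank ℚ (Submodule.span ℚ (Set.range (G.incidence H).col)) :=
        Matrix.rank_eq_finrank_span_cols _
    _ ≤ Module.finrank ℚ (Submodule.span ℚ W) := Submodule.finrank_mono hcols
    _ ≤ W.ncard := (finrank_span_le_card W).trans_eq (Set.ncard_eq_toFinset_card' W).symm
    _ ≤ (G.internalFaces H \ T).ncard := Set.ncard_image_le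

theorem le_divDegree_of_mem_components (hH : H ∈ G.components S)
    (hT : G.ColumnsSpannedOutside T S) :
    ((G.internalFaces H ∩ T).ncard : ℤ) - 2 * H.ncard ≤ G.divDegree H := by
  have hR := incidenceRank_le_ncard_diff hH hT
  have hF := Set.ncard_inter_add_ncard_sdiff_eq_ncard (G.internalFaces H) T
  rw [← numFaces_eq_ncard_internalFaces] at hF
  unfold divDegree numLines
  omega

theorem le_sum_divDegree_components (hT : G.ColumnsSpannedOutside T S) :
    ((G.internalFaces S ∩ T).ncard : ℤ) - 2 * S.ncard ≤
      ∑ H ∈ G.components S, G.divDegree H :=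
  calc ((G.internalFaces S ∩ T).ncard : ℤ) - 2 * S.ncard
      ≤ ∑ H ∈ G.components S, (((G.internalFaces H ∩ T).ncard : ℤ) - 2 * H.ncard) := by
        rw [Finset.sum_sub_distrib, ← Finset.mul_sum, ← sum_ncard_components (G := G) S]
        push_cast
        gcongr
        exact_mod_cast ncard_internalFaces_inter_le S T
    _ ≤ ∑ H ∈ G.components S, G.divDegree H :=
        Finset.sum_le_sum fun _ hH => le_divDegree_of_mem_components hH hT

end DivergenceDegree

section Scales

/-- The scale of an internal face `f`: the least scale of its lines, which is the largest `i` such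
that `f` is internal to `G_i`. -/
noncomputable def faceScale (μ : L → ℕ) (f : G.InternalFace Set.univ) : ℕ :=
  sInf (μ '' {l | G.strandFace l f.1.1 = f.1})

theorem exists_eq_faceScale (μ : L → ℕ) (f : G.InternalFace Set.univ) :
    ∃ l, G.strandFace l f.1.1 = f.1 ∧ μ l = faceScale μ f := by
  obtain ⟨l, -, hl⟩ := f.2.exists_strandFace_eq
  have hne : {l | G.strandFace l f.1.1 = f.1}.Nonempty := ⟨l, hl⟩
  exact Nat.sInf_mem (hne.image μ)

theorem internalFaces_highSubgraph (μ : L → ℕ) (i : ℕ) :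
    G.internalFaces (G.highSubgraph μ i) = {f | i ≤ faceScale μ f} := by
  ext f
  constructor
  · intro hf
    obtain ⟨l, hl, hμl⟩ := exists_eq_faceScale μ f
    exact (IsInternal.mem_of_strandFace_eq hf hl).trans_eq hμl
  · exact fun hi => f.2.of_forall_mem fun l hl => hi.trans (Nat.sInf_le (Set.mem_image_of_mem μ hl))

theorem sum_ncard_internalFaces_inter {μ : L → ℕ} {ρ : ℕ} (hμ : ∀ l, μ l ≤ ρ)
    (T : Finset (G.InternalFace Set.univ)) :
    ∑ i ∈ Finset.Icc 1 ρ, (G.internalFaces (G.highSubgraph μ i) ∩ T).ncard =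
      ∑ f ∈ T, faceScale μ f := by
  have hle : ∀ f ∈ T, faceScale μ f ≤ ρ := fun f _ => by
    obtain ⟨l, -, hl⟩ := exists_eq_faceScale μ f
    exact hl ▸ hμ l
  rw [← sum_card_filter_le_eq_sum T hle]
  refine Finset.sum_congr rfl fun i _ => ?_
  rw [internalFaces_highSubgraph, ← Set.ncard_coe_finset, Finset.coe_filter, Set.inter_comm]
  rfl

theorem sum_ncard_highSubgraph [Fintype L] {μ : L → ℕ} {ρ : ℕ} (hμ : ∀ l, μ l ≤ ρ) :
    ∑ i ∈ Finset.Icc 1 ρ, (G.highSubgraph μ i).ncard = ∑ l, μ l := by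
  rw [← sum_card_filter_le_eq_sum Finset.univ fun l _ => hμ l]
  refine Finset.sum_congr rfl fun i _ => ?_
  rw [← Set.ncard_coe_finset, Finset.coe_filter_univ]
  rfl

theorem exists_freeFaces [Finite V] (G : FeynmanGraph V L) (μ : L → ℕ) (ρ : ℕ) :
    ∃ T : Finset (G.InternalFace Set.univ),
      LinearIndepOn ℚ (G.incidence Set.univ).col (T : Set (G.InternalFace Set.univ))ᶜ ∧
      ∀ i ∈ Finset.Icc 1 ρ, G.ColumnsSpannedOutside T (G.highSubgraph μ i) := by
  classical
  have hanti : Antitone fun i => G.internalFaces (G.highSubgraph μ i) :=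
    fun _ _ hij => internalFaces_mono fun _ hl => hij.trans hl
  obtain ⟨B, -, hli, hspan⟩ := exists_linearIndepOn_adapted_to_antitone (K := ℚ)
    (G.incidence Set.univ).col hanti (Finset.Icc 1 ρ)
  refine ⟨Bᶜ.toFinset, ?_⟩
  simpa only [ColumnsSpannedOutside, Set.coe_toFinset, compl_compl, Set.sdiff_compl] using
    And.intro hli hspan

theorem le_sum_sum_divDegree_components [Finite V] [Fintype L] {μ : L → ℕ} {ρ : ℕ}
    (hμ : ∀ l, μ l ≤ ρ) {T : Finset (G.InternalFace Set.univ)}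
    (hT : ∀ i ∈ Finset.Icc 1 ρ, G.ColumnsSpannedOutside T (G.highSubgraph μ i)) :
    ((∑ f ∈ T, faceScale μ f : ℕ) : ℤ) - 2 * (∑ l, μ l : ℕ) ≤
      ∑ i ∈ Finset.Icc 1 ρ, ∑ H ∈ G.components (G.highSubgraph μ i), G.divDegree H := by
  rw [← sum_ncard_internalFaces_inter hμ, ← sum_ncard_highSubgraph (G := G) hμ, Nat.cast_sum,
    Nat.cast_sum, Finset.mul_sum, ← Finset.sum_sub_distrib]
  exact Finset.sum_le_sum fun i hi => le_sum_divDegree_components (hT i hi)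

theorem pow_div_pow_le_prod_divDegree [Finite V] [Fintype L] {M : ℝ} (hM : 1 ≤ M) {μ : L → ℕ}
    {ρ : ℕ} (hμ : ∀ l, μ l ≤ ρ) {T : Finset (G.InternalFace Set.univ)}
    (hT : ∀ i ∈ Finset.Icc 1 ρ, G.ColumnsSpannedOutside T (G.highSubgraph μ i)) :
    M ^ (∑ f ∈ T, faceScale μ f) / M ^ (2 * ∑ l, μ l) ≤
      ∏ i ∈ Finset.Icc 1 ρ, ∏ H ∈ G.components (G.highSubgraph μ i), M ^ G.divDegree H := by
  have hM0 : M ≠ 0 := (zero_lt_one.trans_le hM).ne'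
  simp_rw [prod_zpow_eq_zpow_sum hM0]
  refine le_trans (le_of_eq ?_) (zpow_le_zpow_right₀ hM (le_sum_sum_divDegree_components hμ hT))
  rw [zpow_sub₀ hM0]
  norm_cast

end Scales

section Momenta

variable {q : G.ExternalFace → ℤ} {p p' : G.InternalFace Set.univ → ℤ}

theorem lineMomentum_of_strandFace_eq {l : L} {c : Fin 6} {f : G.InternalFace Set.univ}
    (h : G.strandFace l c = f.1) : G.lineMomentum q p l c = p f := by
  obtain ⟨f, hf⟩ := f
  obtain rfl : G.strandFace l c = f := h
  exact dif_pos hf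

open Classical in
theorem incidence_eq_sum {S : Set L} (l : S) (f : G.InternalFace S) :
    G.incidence S l f = ∑ c, if G.strandFace l.1 c = f.1 then 1 else 0 := by
  by_cases h : ∃ c, G.strandFace l.1 c = f.1
  · obtain ⟨c, hc⟩ := h
    simp only [incidence, ← hc, (strandFace_injective l.1).eq_iff, exists_eq, if_true,
      Finset.sum_ite_eq', Finset.mem_univ]
  · rw [incidence, if_neg h, Finset.sum_eq_zero fun c _ => if_neg fun hc => h ⟨c, hc⟩]

theorem incidence_mulVec_sub [Finite V] (q : G.ExternalFace → ℤ)
    (p p' : G.InternalFace Set.univ → ℤ) (l : (Set.univ : Set L)) :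
    (G.incidence Set.univ).mulVec (fun f => (p f - p' f : ℚ)) l =
      ∑ c, (G.lineMomentum q p l c - G.lineMomentum q p' l c : ℚ) := by
  classical
  simp only [Matrix.mulVec, dotProduct, incidence_eq_sum, Finset.sum_mul]
  rw [Finset.sum_comm]
  refine Finset.sum_congr rfl fun c _ => ?_
  by_cases hc : G.IsInternal Set.univ (G.strandFace l c)
  · rw [Finset.sum_eq_single ⟨_, hc⟩
      (fun f _ hf => by rw [if_neg fun h => hf (Subtype.ext h.symm), zero_mul])
      fun h => (h (Finset.mem_univ _)).elim]
    simp [lineMomentum, hc]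
  · have hnone : ∀ f : G.InternalFace Set.univ, G.strandFace l c ≠ f.1 :=
      fun f hf => hc (hf ▸ f.2)
    simp [hnone, lineMomentum, hc]

variable (G) in
/-- The momenta of the internal faces that respect the conservation rules and the ultraviolet
cutoffs of all the lines: the only ones that contribute to the amplitude. -/
def admissibleMomenta (M : ℝ) (μ : L → ℕ) (q : G.ExternalFace → ℤ) :
    Set (G.InternalFace Set.univ → ℤ) :=
  {p | ∀ l, ∑ c, G.lineMomentum q p l c = 0 ∧ normSq (G.lineMomentum q p l) ≤ M ^ (2 * μ l)}

variable {M : ℝ} {μ : L → ℕ}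

theorem injOn_restrict_admissibleMomenta [Finite V] {T : Finset (G.InternalFace Set.univ)}
    (hT : LinearIndepOn ℚ (G.incidence Set.univ).col (T : Set (G.InternalFace Set.univ))ᶜ) :
    Set.InjOn T.restrict (G.admissibleMomenta M μ q) := by
  intro p hp p' hp' hpp'
  have hker : (G.incidence Set.univ).mulVec (fun f => (p f - p' f : ℚ)) = 0 := by
    funext l
    rw [incidence_mulVec_sub q, Finset.sum_sub_distrib, ← Int.cast_sum, ← Int.cast_sum,
      (hp l).1, (hp' l).1, sub_self]
    rfl
  have hfree : ∀ f ∉ (T : Set (G.InternalFace Set.univ))ᶜ, (p f - p' f : ℚ) = 0 := by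
    intro f hf
    have hpf : p f = p' f := congrFun hpp' ⟨f, Set.notMem_compl_iff.1 hf⟩
    rw [hpf, sub_self]
  funext f
  have hf := congrFun (eq_zero_of_mulVec_eq_zero_of_linearIndepOn hT hker hfree) f
  exact_mod_cast sub_eq_zero.1 hf

theorem natAbs_le_of_mem_admissibleMomenta (hM : 0 ≤ M) (hp : p ∈ G.admissibleMomenta M μ q)
    (f : G.InternalFace Set.univ) : (p f).natAbs ≤ ⌊M ^ faceScale μ f⌋₊ := by
  obtain ⟨l, hl, hμl⟩ := exists_eq_faceScale μ f
  have hsq : (p f : ℝ) ^ 2 ≤ (M ^ faceScale μ f) ^ 2 :=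
    calc (p f : ℝ) ^ 2 = (G.lineMomentum q p l f.1.1 : ℝ) ^ 2 := by
          rw [lineMomentum_of_strandFace_eq hl]
      _ ≤ normSq (G.lineMomentum q p l) :=
          Finset.single_le_sum (f := fun c => (G.lineMomentum q p l c : ℝ) ^ 2)
            (fun _ _ => sq_nonneg _) (Finset.mem_univ f.1.1)
      _ ≤ M ^ (2 * μ l) := (hp l).2
      _ = (M ^ faceScale μ f) ^ 2 := by rw [hμl, mul_comm, pow_mul]
  refine Nat.le_floor ?_
  rw [Nat.cast_natAbs, Int.cast_abs]
  exact abs_le_of_sq_le_sq hsq (by positivity)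

theorem finite_admissibleMomenta [Finite V] (hM : 0 ≤ M) (μ : L → ℕ) (q : G.ExternalFace → ℤ) :
    (G.admissibleMomenta M μ q).Finite := by
  classical
  let N : G.InternalFace Set.univ → ℤ := fun f => ⌊M ^ faceScale μ f⌋₊
  have hN : ∀ p ∈ G.admissibleMomenta M μ q, ∀ f, |p f| ≤ N f := fun p hp f => by
    rw [Int.abs_eq_natAbs]
    exact Int.ofNat_le.2 (natAbs_le_of_mem_admissibleMomenta hM hp f)
  exact (Set.finite_Icc (-N) N).subset fun p hp =>
    ⟨fun f => (abs_le.1 (hN p hp f)).1, fun f => (abs_le.1 (hN p hp f)).2⟩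

theorem ncard_admissibleMomenta_le [Finite V] (hM : 1 ≤ M)
    {T : Finset (G.InternalFace Set.univ)}
    (hT : LinearIndepOn ℚ (G.incidence Set.univ).col (T : Set (G.InternalFace Set.univ))ᶜ) :
    ((G.admissibleMomenta M μ q).ncard : ℝ) ≤ 3 ^ T.card * M ^ ∑ f ∈ T, faceScale μ f := by
  have hfactor : ∀ f ∈ T, (2 * ⌊M ^ faceScale μ f⌋₊ + 1 : ℝ) ≤ 3 * M ^ faceScale μ f := by
    intro f _
    have hone : 1 ≤ M ^ faceScale μ f := one_le_pow₀ hM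
    have hfloor := Nat.floor_le (zero_le_one.trans hone)
    linarith
  calc ((G.admissibleMomenta M μ q).ncard : ℝ)
      ≤ ∏ f ∈ T, (2 * ⌊M ^ faceScale μ f⌋₊ + 1 : ℝ) := by
        exact_mod_cast ncard_le_prod_of_injOn_restrict (injOn_restrict_admissibleMomenta hT)
          fun p hp f _ => natAbs_le_of_mem_admissibleMomenta (zero_le_one.trans hM) hp f
    _ ≤ ∏ f ∈ T, 3 * M ^ faceScale μ f := Finset.prod_le_prod (fun _ _ => by positivity) hfactor
    _ = 3 ^ T.card * M ^ ∑ f ∈ T, faceScale μ f := by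
        rw [Finset.prod_mul_distrib, Finset.prod_const, Finset.prod_pow_eq_pow_sum]

theorem card_internalFace_le [Finite V] [Fintype L] (S : Set L) :
    Fintype.card (G.InternalFace S) ≤ 6 * Fintype.card L := by
  choose l _ hl using fun f : G.InternalFace S => f.2.exists_strandFace_eq
  have hinj : Function.Injective fun f => (f.1.1, l f) := by
    intro f g hfg
    obtain ⟨hcolor, hline⟩ := Prod.mk.inj hfg
    exact Subtype.ext (by rw [← hl f, ← hl g, hcolor, hline])
  simpa using Fintype.card_le_of_injective _ hinj

end Momenta

end FeynmanGraph

section Propagator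

variable {M m : ℝ} {i : ℕ} {p : Fin 6 → ℤ}

theorem normSq_nonneg (p : Fin 6 → ℤ) : 0 ≤ normSq p := Finset.sum_nonneg fun _ _ => sq_nonneg _

theorem cutoff_ne_zero_iff :
    cutoff M i p ≠ 0 ↔ normSq p ≤ M ^ (2 * i) ∧ (2 ≤ i → M ^ (2 * (i - 1)) < normSq p) := by
  unfold cutoff
  exact ite_ne_right_iff.trans (and_iff_left one_ne_zero)

theorem sum_eq_zero_of_propagator_ne_zero (h : propagator m p ≠ 0) : ∑ c, p c = 0 :=
  (ite_ne_right_iff.1 h).1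

theorem pow_le_of_cutoff_ne_zero (hM : 1 ≤ M) (h : cutoff M i p ≠ 0) :
    M ^ (2 * i) ≤ M ^ 2 * (normSq p + 1) := by
  have hM2 : 0 ≤ M ^ 2 := sq_nonneg M
  rcases le_or_gt 2 i with hi | hi
  · calc M ^ (2 * i) = M ^ 2 * M ^ (2 * (i - 1)) := by rw [← pow_add]; congr 1; omega
      _ ≤ M ^ 2 * (normSq p + 1) := by
          have hlow := (cutoff_ne_zero_iff.1 h).2 hi
          gcongr
          linarith
  · calc M ^ (2 * i) ≤ M ^ 2 := pow_le_pow_right₀ hM (by omega)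
      _ ≤ M ^ 2 * (normSq p + 1) :=
          le_mul_of_one_le_right hM2 (le_add_of_nonneg_left (normSq_nonneg p))

theorem abs_slicedPropagator_le (hM : 1 ≤ M) (hm : m ≠ 0) (i : ℕ) (p : Fin 6 → ℤ) :
    |slicedPropagator M m i p| ≤ M ^ 2 * (1 + 1 / m ^ 2) / M ^ (2 * i) := by
  have : 0 < M := zero_lt_one.trans_le hM
  have hn := normSq_nonneg p
  by_cases h : slicedPropagator M m i p = 0
  · rw [h, abs_zero]
    positivity
  have hC : propagator m p ≠ 0 := left_ne_zero_of_mul h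
  have hχ : cutoff M i p ≠ 0 := right_ne_zero_of_mul h
  have hvalue : slicedPropagator M m i p = 1 / (normSq p + m ^ 2) := by
    rw [slicedPropagator, propagator, if_pos (sum_eq_zero_of_propagator_ne_zero hC), cutoff,
      if_pos (cutoff_ne_zero_iff.1 hχ), mul_one]
  have hmass : normSq p + 1 ≤ (1 + 1 / m ^ 2) * (normSq p + m ^ 2) := by
    have hexpand : (1 + 1 / m ^ 2) * (normSq p + m ^ 2) =
        normSq p + 1 + (m ^ 2 + normSq p / m ^ 2) := by
      field_simp
      ring
    rw [hexpand]
    exact le_add_of_nonneg_right (by positivity)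
  rw [hvalue, abs_of_nonneg (by positivity), div_le_div_iff₀ (by positivity) (by positivity),
    one_mul]
  calc M ^ (2 * i) ≤ M ^ 2 * (normSq p + 1) := pow_le_of_cutoff_ne_zero hM hχ
    _ ≤ M ^ 2 * ((1 + 1 / m ^ 2) * (normSq p + m ^ 2)) := by gcongr
    _ = M ^ 2 * (1 + 1 / m ^ 2) * (normSq p + m ^ 2) := (mul_assoc _ _ _).symm

end Propagator

namespace FeynmanGraph

section Amplitude

variable {V L : Type*} [Fintype L] {G : FeynmanGraph V L} {M m : ℝ}

theorem numLines_univ : G.numLines Set.univ = Fintype.card L := by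
  rw [numLines, Set.ncard_univ, Nat.card_eq_fintype_card]

theorem support_integrand_subset (M m : ℝ) (μ : L → ℕ) (q : G.ExternalFace → ℤ) :
    Function.support (G.integrand M m μ q) ⊆ G.admissibleMomenta M μ q := by
  intro p hp l
  have hl : slicedPropagator M m (μ l) (G.lineMomentum q p l) ≠ 0 :=
    Finset.prod_ne_zero_iff.1 hp l (Finset.mem_univ l)
  exact ⟨sum_eq_zero_of_propagator_ne_zero (left_ne_zero_of_mul hl),
    (cutoff_ne_zero_iff.1 (right_ne_zero_of_mul hl)).1⟩

theorem abs_integrand_le (hM : 1 ≤ M) (hm : m ≠ 0) (μ : L → ℕ) (q : G.ExternalFace → ℤ)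
    (p : G.InternalFace Set.univ → ℤ) :
    |G.integrand M m μ q p| ≤
      (M ^ 2 * (1 + 1 / m ^ 2)) ^ Fintype.card L / M ^ (2 * ∑ l, μ l) :=
  calc |G.integrand M m μ q p|
      = ∏ l, |slicedPropagator M m (μ l) (G.lineMomentum q p l)| := Finset.abs_prod _ _
    _ ≤ ∏ l, M ^ 2 * (1 + 1 / m ^ 2) / M ^ (2 * μ l) :=
        Finset.prod_le_prod (fun _ _ => abs_nonneg _) fun l _ => abs_slicedPropagator_le hM hm _ _
    _ = (M ^ 2 * (1 + 1 / m ^ 2)) ^ Fintype.card L / M ^ (2 * ∑ l, μ l) := by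
        rw [Finset.prod_div_distrib, Finset.prod_const, Finset.card_univ,
          Finset.prod_pow_eq_pow_sum, ← Finset.mul_sum]

theorem summable_integrand [Finite V] (hM : 0 ≤ M) (m : ℝ) (μ : L → ℕ)
    (q : G.ExternalFace → ℤ) : Summable (G.integrand M m μ q) :=
  summable_of_hasFiniteSupport
    ((finite_admissibleMomenta hM μ q).subset (support_integrand_subset M m μ q))

theorem abs_amplitude_le [Finite V] (hM : 1 ≤ M) (hm : m ≠ 0) (μ : L → ℕ)
    (q : G.ExternalFace → ℤ) {T : Finset (G.InternalFace Set.univ)}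
    (hT : LinearIndepOn ℚ (G.incidence Set.univ).col (T : Set (G.InternalFace Set.univ))ᶜ) :
    |G.amplitude M m μ q| ≤
      (3 ^ 6 * (M ^ 2 * (1 + 1 / m ^ 2))) ^ Fintype.card L *
        (M ^ (∑ f ∈ T, faceScale μ f) / M ^ (2 * ∑ l, μ l)) := by
  have hM0 : 0 ≤ M := zero_le_one.trans hM
  have hcard : T.card ≤ 6 * Fintype.card L :=
    (Finset.card_le_univ T).trans (card_internalFace_le _)
  set C := M ^ 2 * (1 + 1 / m ^ 2)
  calc |G.amplitude M m μ q|
      ≤ (G.admissibleMomenta M μ q).ncard * (C ^ Fintype.card L / M ^ (2 * ∑ l, μ l)) :=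
        norm_tsum_le_ncard_mul (finite_admissibleMomenta hM0 μ q)
          (support_integrand_subset M m μ q) fun p _ => abs_integrand_le hM hm μ q p
    _ ≤ 3 ^ T.card * M ^ (∑ f ∈ T, faceScale μ f) *
          (C ^ Fintype.card L / M ^ (2 * ∑ l, μ l)) := by
        gcongr
        exact ncard_admissibleMomenta_le hM hT
    _ ≤ 3 ^ (6 * Fintype.card L) * M ^ (∑ f ∈ T, faceScale μ f) *
          (C ^ Fintype.card L / M ^ (2 * ∑ l, μ l)) := by
        gcongr
        norm_num
    _ = (3 ^ 6 * C) ^ Fintype.card L *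
          (M ^ (∑ f ∈ T, faceScale μ f) / M ^ (2 * ∑ l, μ l)) := by
        rw [pow_mul, mul_pow (3 ^ 6 : ℝ)]
        ring

end Amplitude

end FeynmanGraph

end TGFT

theorem mainTheorem4 (M m : ℝ) (hM : 1 < M) (hm : 0 < m) :
    ∃ K : ℝ, 0 < K ∧
      ∀ (V L : Type*) [Fintype V] [Fintype L] (G : TGFT.FeynmanGraph V L)
        (ρ : ℕ) (μ : L → ℕ), (∀ l, 1 ≤ μ l ∧ μ l ≤ ρ) →
        ∀ q : G.ExternalFace → ℤ,
          Summable (G.integrand M m μ q) ∧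
          |G.amplitude M m μ q| ≤
            K ^ G.numLines Set.univ *
              ∏ i ∈ Finset.Icc 1 ρ, ∏ H ∈ G.components (G.highSubgraph μ i),
                M ^ G.divDegree H := by
  have hM0 : 0 < M := zero_lt_one.trans hM
  refine ⟨3 ^ 6 * (M ^ 2 * (1 + 1 / m ^ 2)), by positivity, ?_⟩
  intro V L _ _ G ρ μ hμ q
  refine ⟨TGFT.FeynmanGraph.summable_integrand hM0.le m μ q, ?_⟩
  obtain ⟨T, hli, hspan⟩ := G.exists_freeFaces μ ρ
  rw [TGFT.FeynmanGraph.numLines_univ]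
  refine (TGFT.FeynmanGraph.abs_amplitude_le hM.le hm.ne' μ q hli).trans ?_
  gcongr
  exact TGFT.FeynmanGraph.pow_div_pow_le_prod_divDegree hM.le (fun l => (hμ l).2) hspan
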